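/- Let $n \ge 1$, let $B$ be an $n \times n$ real symmetric positive semidefinite matrix, and for a positive semidefinite matrix $A$ write $\|v\|_A := \langle A v, v\rangle^{1/2}$. Let $f : \mathbb{R}^n \to \mathbb{R}$ be differentiable, bounded from below, and 1-smooth with respect to $\|\cdot\|_B$, i.e. $$f(y) \le f(x) + \langle \nabla f(x), y - x\rangle + \tfrac12 \|y - x\|_B^2 \quad \text{for all } x, y \in \mathbb{R}^n.$$ Let $x_0 \in \mathbb{R}^n$ and $1 \le \tau \le \operatorname{Rank}(B)$. For a $\tau$-element set $S \subseteq \{1,\dots,n\}$, let $I_S$ consist of the columns of the $n \times n$ identity matrix $I$ with indices in $S$, and put $B_{S\times S} := I_S^T B I_S$ and $v_S := I_S^T v$. Let $S_0$ be a random $\tau$-element subset of $\{1,\dots,n\}$ distributed according to volume sampling $\operatorname{Vol}_\tau(B)$, i.e. for every $\tau$-element set $S$, $$\Pr(S_0 = S) = \frac{\det(B_{S\times S})}{\sum_{S'} \det(B_{S'\times S'})},$$ where the sum is over all $\tau$-element subsets $S'$ of $\{1,\dots,n\}$. (Some of the matrices $B_{S \times S}$ may be singular; these have probability zero.) Let $$x_1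 := x_0 - I_{S_0} (B_{S_0\times S_0})^{-1} \nabla f(x_0)_{S_0}.$$ Let $B = Q \operatorname{Diag}(\lambda_1, \dots, \lambda_n) Q^T$ be any spectral decomposition of $B$ with $Q$ orthogonal and $\lambda_1 \ge \dots \ge \lambda_n$, and let $$B_\tau := Q \operatorname{Diag}(\lambda_1, \dots, \lambda_\tau, \lambda_\tau, \dots, \lambda_\tau) Q^T + \Big(\sum_{i=\tau+1}^n \lambda_i\Big) I$$ be the $\tau$-coordinate approximation of $B$. Then $f(x_1) \le f(x_0)$ almost surely, $f(x_1)$ is integrable, and $$f(x_0) - \mathbb{E} f(x_1) \ge \tfrac12 \|\nabla f(x_0)\|_{(B_\tau)^{-1}}^2.$$ -/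

import Mathlib

open MeasureTheory

namespace RCDVS

noncomputable section

/-- The seminorm `‖v‖_B = ⟨B v, v⟩^{1/2}` induced by a positive semidefinite matrix `B`. -/
def matSeminorm {n : ℕ} (B : Matrix (Fin n) (Fin n) ℝ) (v : EuclideanSpace ℝ (Fin n)) : ℝ :=
  Real.sqrt (inner ℝ (WithLp.toLp 2 (B.mulVec v.ofLp)) v)

/-- The differentiable function `f` is 1-smooth with respect to the seminorm `‖·‖_B`:
`f y ≤ f x + ⟨∇f x, y - x⟩ + ½ ‖y - x‖_B²` for all `x, y`. -/
structure IsOneSmooth {n : ℕ} (f : EuclideanSpace ℝ (Fin n) → ℝ)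
    (B : Matrix (Fin n) (Fin n) ℝ) : Prop where
  differentiable : Differentiable ℝ f
  le_quadratic : ∀ x y : EuclideanSpace ℝ (Fin n),
    f y ≤ f x + inner ℝ (gradient f x) (y - x) + 1 / 2 * matSeminorm B (y - x) ^ 2

/-- The `τ`-element subsets of the `n` coordinates. -/
abbrev CoordSubset (n τ : ℕ) : Type := {S : Finset (Fin n) // S.card = τ}

/-- The matrix `I_S`: the columns of the identity matrix with indices in `S`. -/
def colSelect {n : ℕ} (S : Finset (Fin n)) : Matrix (Fin n) S ℝ :=
  (1 : Matrix (Fin n) (Fin n) ℝ).submatrix id Subtype.val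

/-- The principal submatrix `B_{S × S}`. -/
def principalSub {n : ℕ} (B : Matrix (Fin n) (Fin n) ℝ) (S : Finset (Fin n)) : Matrix S S ℝ :=
  B.submatrix Subtype.val Subtype.val

/-- The subvector `v_S`. -/
def subvec {n : ℕ} (v : EuclideanSpace ℝ (Fin n)) (S : Finset (Fin n)) : S → ℝ :=
  fun i => v i.val

/-- One step `x - I_S (B_{S × S})⁻¹ (∇f x)_S` of the block coordinate descent method. -/
def step {n : ℕ} (f : EuclideanSpace ℝ (Fin n) → ℝ) (B : Matrix (Fin n) (Fin n) ℝ)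
    (x : EuclideanSpace ℝ (Fin n)) (S : Finset (Fin n)) : EuclideanSpace ℝ (Fin n) :=
  x - WithLp.toLp 2
    ((colSelect S).mulVec ((principalSub B S)⁻¹.mulVec (subvec (gradient f x) S)))

/-- The random `τ`-element subset `S₀` is distributed according to `τ`-element volume sampling
with respect to `B`. The finite set of values carries the discrete σ-algebra. -/
structure IsVolumeSampling {n τ : ℕ} {Ω : Type*} [MeasurableSpace Ω] (μ : Measure Ω)
    (B : Matrix (Fin n) (Fin n) ℝ) (S₀ : Ω → CoordSubset n τ) : Prop where
  measurable : Measurable[_, ⊤] S₀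
  prob_eq : ∀ S : CoordSubset n τ, μ.real {ω | S₀ ω = S} =
    (principalSub B S.val).det / ∑ S' : CoordSubset n τ, (principalSub B S'.val).det

/-- `B = Q Diag(lam) Qᵀ` is a spectral decomposition with `Q` orthogonal and the eigenvalues
listed in non-increasing order. -/
structure IsSpectralDecomp {n : ℕ} (B Q : Matrix (Fin n) (Fin n) ℝ) (lam : Fin n → ℝ) :
    Prop where
  orthogonal : Q ∈ Matrix.orthogonalGroup (Fin n) ℝ
  antitone : Antitone lam
  eq : B = Q * Matrix.diagonal lam * Q.transpose

/-- Every real symmetric matrix has a spectral decomposition in the above sense. -/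
theorem exists_isSpectralDecomp {n : ℕ} {B : Matrix (Fin n) (Fin n) ℝ} (hB : B.IsHermitian) :
    ∃ Q lam, IsSpectralDecomp B Q lam := by
  let e : Fin n ≃ Fin n := (finCongr (Fintype.card_fin n).symm).trans
    (Fintype.equivOfCardEq (Fintype.card_fin _))
  let U : Matrix (Fin n) (Fin n) ℝ := hB.eigenvectorUnitary
  have hU : U * U.transpose = 1 :=
    (Matrix.mem_orthogonalGroup_iff (Fin n) ℝ).mp hB.eigenvectorUnitary.2
  have hspec : B = U * Matrix.diagonal hB.eigenvalues * U.transpose := by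
    have h := hB.spectral_theorem
    rw [Unitary.conjStarAlgAut_apply] at h
    exact h
  refine ⟨U.submatrix id e, hB.eigenvalues ∘ e, ?_, ?_, ?_⟩
  · rw [Matrix.mem_orthogonalGroup_iff]
    change U.submatrix id e * (U.submatrix id e).transpose = 1
    rw [Matrix.transpose_submatrix, Matrix.submatrix_mul_equiv, hU, Matrix.submatrix_id_id]
  · intro i j hij
    simp only [Function.comp_apply, Matrix.IsHermitian.eigenvalues]
    apply hB.eigenvalues₀_antitone
    simpa [e] using hij
  · rw [← Matrix.submatrix_diagonal_equiv, Matrix.transpose_submatrix,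
      Matrix.submatrix_mul_equiv, Matrix.submatrix_mul_equiv, Matrix.submatrix_id_id]
    exact hspec

/-- The `τ`-coordinate approximation
`Q Diag(λ₁, …, λ_τ, λ_τ, …, λ_τ) Qᵀ + (∑_{i > τ} λ_i) I` (for `τ ≥ 1`) of the matrix with spectral
decomposition `Q Diag(λ₁, …, λ_n) Qᵀ`. As `Fin n` starts at `0`, the eigenvalue written `λ_i` here
is `lam (i - 1)`. -/
def coordApprox {n : ℕ} (Q : Matrix (Fin n) (Fin n) ℝ) (lam : Fin n → ℝ) (τ : ℕ) :
    Matrix (Fin n) (Fin n) ℝ :=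
  Q * Matrix.diagonal
      (fun i : Fin n => lam ⟨min i.val (τ - 1), lt_of_le_of_lt (min_le_left _ _) i.isLt⟩) *
    Q.transpose +
  (∑ i : Fin n with τ ≤ i.val, lam i) • (1 : Matrix (Fin n) (Fin n) ℝ)

end

end RCDVS

/-! Write g for the gradient at `x₀`. Smoothness bounds the decrease for block S below by ½
g_Sᵀ(B_SS)⁻¹g_S. Volume sampling weights this by det B_SS, and the matrix determinant lemma turns
det B_SS · g_Sᵀ(B_SS)⁻¹g_S into det(B + ggᵀ)_SS − det B_SS. Sums of τ×τ principal minors are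
invariant under orthogonal conjugation, so B may be replaced by Diag(λ) and g by h = Qᵀg. There the
weighted sum is ∑ᵢ hᵢ² ∂ᵢe_τ(λ), while the normalizing constant is e_τ(λ), with e_τ the elementary
symmetric polynomial (`sum_det_mul_quadratic_eq`).

It remains to show e_τ(λ) ≤ μᵢ ∂ᵢe_τ(λ) for each eigenvalue μᵢ of B_τ (`sum_det_le`). This follows
from an injective exchange argument on τ-sets (`sum_powersetCard_prod_le`).

Singular blocks are harmless: boundedness below makes g orthogonal to ker B, which keeps the
determinant identity valid for them. -/

namespace RCDVS

open Matrix Polynomial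

/-! ### Determinants and principal minors. -/

section LinearAlgebra

variable {m : Type*} [Fintype m] [DecidableEq m]

/-- The matrix determinant lemma for a symmetric rank one update by a vector orthogonal to the
kernel, valid for singular matrices as well. -/
theorem det_add_vecMulVec_self (M : Matrix m m ℝ) (g : m → ℝ)
    (hg : ∀ w, M *ᵥ w = 0 → g ⬝ᵥ w = 0) :
    (M + vecMulVec g g).det = M.det * (1 + g ⬝ᵥ (M⁻¹ *ᵥ g)) := by
  by_cases hM : M.det = 0
  · obtain ⟨w, hw0, hw⟩ := Matrix.exists_mulVec_eq_zero_iff.mpr hM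
    rw [hM, zero_mul, ← Matrix.exists_mulVec_eq_zero_iff]
    -- A kernel vector of M is orthogonal to g, so it stays in the kernel after the update and both
    -- determinants vanish.
    refine ⟨w, hw0, ?_⟩
    rw [add_mulVec, hw, vecMulVec_mulVec, hg w hw]
    simp
  · rw [vecMulVec_eq Unit, det_add_replicateCol_mul_replicateRow (isUnit_iff_ne_zero.mpr hM),
      det_unique (n := Unit), Matrix.add_apply, one_apply_eq, Matrix.mul_assoc, mul_apply]
    simp [dotProduct, mulVec, Matrix.mul_apply]

/-- Sums of principal minors of a given size are invariant under orthogonal conjugation. -/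
theorem sum_minors_orthogonal_conj (M Q : Matrix m m ℝ) (hQ : Q.transpose * Q = 1) (k : ℕ) :
    ∑ s ∈ Finset.univ.powersetCard k,
      ((Q * M * Q.transpose).submatrix (Subtype.val : s → m) (Subtype.val : s → m)).det =
    ∑ s ∈ Finset.univ.powersetCard k,
      (M.submatrix (Subtype.val : s → m) (Subtype.val : s → m)).det := by
  -- The sum is the coefficient of X^k in det(1 + X M), so det(1 + AB) = det(1 + BA) gives the
  -- invariance.
  rw [← coeff_det_one_add_X_smul_eq_sum_minors, ← coeff_det_one_add_X_smul_eq_sum_minors]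
  have h1 : (X : ℝ[X]) • (Q * M * Q.transpose).map C =
      Q.map C * ((X : ℝ[X]) • (M * Q.transpose).map C) := by
    rw [Matrix.mul_smul, ← Matrix.map_mul, Matrix.mul_assoc]
  rw [h1, det_one_add_mul_comm, Matrix.smul_mul, ← Matrix.map_mul, Matrix.mul_assoc, hQ,
    Matrix.mul_one]

end LinearAlgebra

/-! ### An exchange inequality for elementary symmetric polynomials. -/

section Combinatorics

variable {ι : Type*} [DecidableEq ι]

/-- If `K` contains `i` and meets all `k`-element sets, then the `k`-th elementary symmetric
polynomial is at most `∑ j ∈ K, a j` times its partial derivative with respect to `a i`. -/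
theorem sum_powersetCard_prod_le (U : Finset ι) (a : ι → ℝ) (ha : ∀ i, 0 ≤ a i) (k : ℕ)
    {i : ι} (hiU : i ∈ U) (K : Finset ι) (hi : i ∈ K)
    (hK : ∀ T ∈ U.powersetCard k, ∃ j ∈ T, j ∈ K) :
    ∑ T ∈ U.powersetCard k, ∏ j ∈ T, a j ≤
      (∑ j ∈ K, a j) * ∑ T ∈ U.powersetCard k with i ∈ T, ∏ j ∈ T.erase i, a j := by
  -- Each k-set T gives up an element s(T) of K, namely i itself whenever i ∈ T, and receives i in
  -- exchange.
  have hsel : ∀ T, ∃ j, T ∈ U.powersetCard k → j ∈ T ∧ j ∈ K ∧ (i ∈ T → j = i) := by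
    intro T
    by_cases hiT : i ∈ T
    · exact ⟨i, fun _ => ⟨hiT, hi, fun _ => rfl⟩⟩
    · by_cases hT : T ∈ U.powersetCard k
      · obtain ⟨j, hj, hjK⟩ := hK T hT
        exact ⟨j, fun _ => ⟨hj, hjK, fun h => absurd h hiT⟩⟩
      · exact ⟨i, fun h => absurd h hT⟩
  choose s hs using hsel
  have hnot : ∀ T ∈ U.powersetCard k, i ∉ T.erase (s T) := by
    intro T hT h
    rw [Finset.mem_erase] at h
    exact h.1 ((hs T hT).2.2 h.2).symm
  rw [Finset.sum_mul_sum, ← Finset.sum_product']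
  -- T is recovered by removing i from the new set and putting s(T) back. The monomial of T is thus
  -- a distinct term of the expanded right-hand side, whose other terms are nonnegative.
  have hinj : Set.InjOn (fun T => (s T, insert i (T.erase (s T)))) (U.powersetCard k) := by
    intro T hT T' hT' h
    simp only [Prod.mk.injEq] at h
    rw [← Finset.insert_erase (hs T hT).1, ← Finset.erase_insert (hnot T hT), h.2, h.1,
      Finset.erase_insert (hnot T' hT'), Finset.insert_erase (hs T' hT').1]
  have himg : ∑ T ∈ U.powersetCard k, ∏ j ∈ T, a j =
      ∑ p ∈ (U.powersetCard k).image (fun T => (s T, insert i (T.erase (s T)))),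
        a p.1 * ∏ j ∈ p.2.erase i, a j := by
    rw [Finset.sum_image hinj]
    refine Finset.sum_congr rfl fun T hT => ?_
    simp only
    rw [Finset.erase_insert (hnot T hT), Finset.mul_prod_erase T a (hs T hT).1]
  rw [himg]
  refine Finset.sum_le_sum_of_subset_of_nonneg ?_ fun p _ _ =>
    mul_nonneg (ha _) (Finset.prod_nonneg fun j _ => ha j)
  intro p hp
  obtain ⟨T, hT, rfl⟩ := Finset.mem_image.mp hp
  have hT' := Finset.mem_powersetCard.mp hT
  simp only [Finset.mem_product, Finset.mem_filter, Finset.mem_powersetCard,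
    Finset.mem_insert_self, and_true]
  refine ⟨(hs T hT).2.1, Finset.insert_subset hiU ((Finset.erase_subset _ _).trans hT'.1), ?_⟩
  rw [Finset.card_insert_of_notMem (hnot T hT), Finset.card_erase_of_mem (hs T hT).1, hT'.2]
  have := Finset.card_pos.mpr ⟨_, (hs T hT).1⟩
  omega

end Combinatorics

/-! ### Decrease of f in one block step. -/

section Descent

variable {n : ℕ}

theorem principalSub_eq (B : Matrix (Fin n) (Fin n) ℝ) (S : Finset (Fin n)) :
    principalSub B S = (colSelect S).transpose * B * colSelect S := by
  ext i j
  simp [principalSub, colSelect, Matrix.mul_apply, Matrix.one_apply]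

theorem subvec_eq (v : EuclideanSpace ℝ (Fin n)) (S : Finset (Fin n)) :
    subvec v S = (colSelect S).transpose *ᵥ v.ofLp := by
  ext i
  simp [subvec, colSelect, Matrix.mulVec, dotProduct, Matrix.one_apply]

theorem dotProduct_colSelect_mulVec (v : EuclideanSpace ℝ (Fin n)) (S : Finset (Fin n))
    (w : S → ℝ) : v.ofLp ⬝ᵥ (colSelect S *ᵥ w) = subvec v S ⬝ᵥ w := by
  rw [subvec_eq, dotProduct_mulVec, mulVec_transpose]

theorem colSelect_quadratic (B : Matrix (Fin n) (Fin n) ℝ) (S : Finset (Fin n)) (w : S → ℝ) :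
    (colSelect S *ᵥ w) ⬝ᵥ (B *ᵥ (colSelect S *ᵥ w)) = w ⬝ᵥ (principalSub B S *ᵥ w) := by
  rw [principalSub_eq, ← mulVec_mulVec, ← mulVec_mulVec, dotProduct_mulVec w, vecMul_transpose]

theorem matSeminorm_sq {A : Matrix (Fin n) (Fin n) ℝ} {v : EuclideanSpace ℝ (Fin n)}
    (h : 0 ≤ v.ofLp ⬝ᵥ (A *ᵥ v.ofLp)) :
    matSeminorm A v ^ 2 = v.ofLp ⬝ᵥ (A *ᵥ v.ofLp) := by
  rw [matSeminorm, EuclideanSpace.inner_eq_star_dotProduct, Real.sq_sqrt]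
  · simp
  · simpa using h

theorem quadratic_nonneg {m : Type*} [Fintype m] {M : Matrix m m ℝ} (hM : M.PosSemidef)
    (v : m → ℝ) : 0 ≤ v ⬝ᵥ (M *ᵥ v) := by
  simpa using hM.dotProduct_mulVec_nonneg v

variable {f : EuclideanSpace ℝ (Fin n) → ℝ} {B : Matrix (Fin n) (Fin n) ℝ}

theorem IsOneSmooth.le_add (hf : IsOneSmooth f B) (hB : B.PosSemidef)
    (x : EuclideanSpace ℝ (Fin n)) (v : Fin n → ℝ) :
    f (x + WithLp.toLp 2 v) ≤
      f x + (gradient f x).ofLp ⬝ᵥ v + 1 / 2 * (v ⬝ᵥ (B *ᵥ v)) := by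
  have h := hf.le_quadratic x (x + WithLp.toLp 2 v)
  rw [add_sub_cancel_left, matSeminorm_sq (quadratic_nonneg hB _),
    EuclideanSpace.inner_eq_star_dotProduct, dotProduct_comm] at h
  simpa using h

/-- The gradient of a function bounded below is orthogonal to the kernel of its smoothness
matrix. -/
theorem IsOneSmooth.gradient_dotProduct_eq_zero (hf : IsOneSmooth f B) (hB : B.PosSemidef)
    (hbdd : BddBelow (Set.range f)) (x : EuclideanSpace ℝ (Fin n)) (v : Fin n → ℝ)
    (hv : B *ᵥ v = 0) : (gradient f x).ofLp ⬝ᵥ v = 0 := by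
  obtain ⟨c, hc⟩ := hbdd
  by_contra hne
  -- Along ker B the quadratic term vanishes; this multiple of v makes the upper bound equal to c −
  -- 1, below the lower bound c.
  have h := hf.le_add hB x (((c - f x - 1) / ((gradient f x).ofLp ⬝ᵥ v)) • v)
  rw [mulVec_smul, hv, smul_zero, dotProduct_zero, dotProduct_smul, smul_eq_mul,
    div_mul_cancel₀ _ hne] at h
  have := hc (Set.mem_range_self
    (x + WithLp.toLp 2 (((c - f x - 1) / ((gradient f x).ofLp ⬝ᵥ v)) • v)))
  linarith

/-- Orthogonality to the kernel passes to blocks: if B_SS w = 0, the quadratic form of B vanishes at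
I_S w, and semidefiniteness forces B I_S w = 0. -/
theorem subvec_dotProduct_eq_zero (hB : B.PosSemidef) {g : EuclideanSpace ℝ (Fin n)}
    (hg : ∀ v, B *ᵥ v = 0 → g.ofLp ⬝ᵥ v = 0) (S : Finset (Fin n)) (w : S → ℝ)
    (hw : principalSub B S *ᵥ w = 0) : subvec g S ⬝ᵥ w = 0 := by
  rw [← dotProduct_colSelect_mulVec]
  apply hg
  rw [← hB.dotProduct_mulVec_zero_iff, star_trivial, colSelect_quadratic, hw, dotProduct_zero]

theorem IsOneSmooth.step_le (hf : IsOneSmooth f B) (hB : B.PosSemidef)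
    (x : EuclideanSpace ℝ (Fin n)) (S : Finset (Fin n)) :
    f (step f B x S) ≤ f x -
      1 / 2 * (subvec (gradient f x) S ⬝ᵥ ((principalSub B S)⁻¹ *ᵥ subvec (gradient f x) S)) := by
  have h := hf.le_add hB x (-(colSelect S *ᵥ ((principalSub B S)⁻¹ *ᵥ subvec (gradient f x) S)))
  rw [mulVec_neg, neg_dotProduct_neg, dotProduct_neg, colSelect_quadratic,
    dotProduct_colSelect_mulVec] at h
  have hq : ((principalSub B S)⁻¹ *ᵥ subvec (gradient f x) S) ⬝ᵥ
      (principalSub B S *ᵥ ((principalSub B S)⁻¹ *ᵥ subvec (gradient f x) S)) =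
      subvec (gradient f x) S ⬝ᵥ ((principalSub B S)⁻¹ *ᵥ subvec (gradient f x) S) := by
    by_cases hdet : IsUnit (principalSub B S).det
    · rw [mulVec_mulVec _ (principalSub B S), mul_nonsing_inv _ hdet, one_mulVec, dotProduct_comm]
    -- For a singular block the inverse is 0 by convention, so both sides vanish and the step does
    -- not move.
    · simp [nonsing_inv_apply_not_isUnit _ hdet]
  rw [hq, WithLp.toLp_neg, ← sub_eq_add_neg] at h
  rw [step]
  linarith

theorem principalSub_posSemidef (hB : B.PosSemidef) (S : Finset (Fin n)) :
    (principalSub B S).PosSemidef := hB.submatrix _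

end Descent

/-! ### Volume-weighted sums in the eigenbasis. -/

section VolumeSum

variable {n : ℕ}

theorem sum_det_mul_quadratic {B : Matrix (Fin n) (Fin n) ℝ} (hB : B.PosSemidef)
    (g : EuclideanSpace ℝ (Fin n)) (hg : ∀ v, B *ᵥ v = 0 → g.ofLp ⬝ᵥ v = 0) (k : ℕ) :
    ∑ S ∈ Finset.univ.powersetCard k, (principalSub B S).det *
        (subvec g S ⬝ᵥ ((principalSub B S)⁻¹ *ᵥ subvec g S)) =
      ∑ S ∈ Finset.univ.powersetCard k, (principalSub (B + vecMulVec g.ofLp g.ofLp) S).det -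
        ∑ S ∈ Finset.univ.powersetCard k, (principalSub B S).det := by
  rw [← Finset.sum_sub_distrib]
  refine Finset.sum_congr rfl fun S _ => ?_
  have h : principalSub (B + vecMulVec g.ofLp g.ofLp) S =
      principalSub B S + vecMulVec (subvec g S) (subvec g S) := by
    ext i j
    simp [principalSub, subvec, vecMulVec_apply]
  rw [h, det_add_vecMulVec_self _ _ (subvec_dotProduct_eq_zero hB hg S)]
  ring

theorem principalSub_diagonal (lam : Fin n → ℝ) (S : Finset (Fin n)) :
    principalSub (diagonal lam) S = diagonal fun i : S => lam i := by
  exact submatrix_diagonal lam _ Subtype.val_injective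

theorem det_principalSub_diagonal (lam : Fin n → ℝ) (S : Finset (Fin n)) :
    (principalSub (diagonal lam) S).det = ∏ i ∈ S, lam i := by
  rw [principalSub_diagonal, det_diagonal, Finset.prod_coe_sort S lam]

/-- Each 1/λᵢ cancels one factor of the determinant. If some λᵢ with i ∈ S is zero, the left side
vanishes through the determinant; on the right, the i-th term contains hᵢ = 0 and every other term
contains λᵢ. -/
theorem det_mul_quadratic_diagonal (lam : Fin n → ℝ) (h : EuclideanSpace ℝ (Fin n))
    (hh : ∀ i, lam i = 0 → h i = 0) (S : Finset (Fin n)) :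
    (principalSub (diagonal lam) S).det *
        (subvec h S ⬝ᵥ ((principalSub (diagonal lam) S)⁻¹ *ᵥ subvec h S)) =
      ∑ i ∈ S, h i ^ 2 * ∏ j ∈ S.erase i, lam j := by
  rw [det_principalSub_diagonal]
  by_cases hS : ∃ i ∈ S, lam i = 0
  · obtain ⟨i, hiS, hi⟩ := hS
    rw [Finset.prod_eq_zero hiS hi, zero_mul, eq_comm]
    refine Finset.sum_eq_zero fun j _ => ?_
    by_cases hij : j = i
    · rw [hij, hh i hi]
      simp
    · rw [Finset.prod_eq_zero (Finset.mem_erase.mpr ⟨Ne.symm hij, hiS⟩) hi, mul_zero]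
  · push Not at hS
    have hinv : (principalSub (diagonal lam) S)⁻¹ = diagonal fun i : S => (lam i)⁻¹ := by
      refine inv_eq_right_inv ?_
      rw [principalSub_diagonal, diagonal_mul_diagonal, ← diagonal_one]
      congr 1
      ext i
      exact mul_inv_cancel₀ (hS i i.2)
    rw [hinv, dotProduct, Finset.mul_sum, ← Finset.sum_coe_sort S]
    refine Finset.sum_congr rfl fun i _ => ?_
    rw [mulVec_diagonal, ← Finset.mul_prod_erase S lam i.2]
    have := hS i i.2
    simp only [subvec]
    field_simp

variable {B Q : Matrix (Fin n) (Fin n) ℝ} {lam : Fin n → ℝ}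

theorem IsSpectralDecomp.transpose_mul (hQ : IsSpectralDecomp B Q lam) :
    Q.transpose * Q = 1 :=
  (Matrix.mem_orthogonalGroup_iff' (Fin n) ℝ).mp hQ.orthogonal

theorem IsSpectralDecomp.mul_transpose (hQ : IsSpectralDecomp B Q lam) :
    Q * Q.transpose = 1 :=
  (Matrix.mem_orthogonalGroup_iff (Fin n) ℝ).mp hQ.orthogonal

theorem IsSpectralDecomp.transpose_mul_mul (hQ : IsSpectralDecomp B Q lam) :
    Q.transpose * B * Q = diagonal lam := by
  rw [hQ.eq, Matrix.mul_assoc, Matrix.mul_assoc, hQ.transpose_mul, Matrix.mul_one,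
    ← Matrix.mul_assoc, hQ.transpose_mul, Matrix.one_mul]

theorem IsSpectralDecomp.diagonal_posSemidef (hQ : IsSpectralDecomp B Q lam)
    (hB : B.PosSemidef) : (diagonal lam).PosSemidef := by
  have h := hB.conjTranspose_mul_mul_same Q
  rwa [conjTranspose_eq_transpose_of_trivial, hQ.transpose_mul_mul] at h

theorem IsSpectralDecomp.nonneg (hQ : IsSpectralDecomp B Q lam) (hB : B.PosSemidef) (i : Fin n) :
    0 ≤ lam i :=
  Matrix.posSemidef_diagonal_iff.mp (hQ.diagonal_posSemidef hB) i

/-- The leading `B.rank` eigenvalues are positive. -/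
theorem IsSpectralDecomp.pos_of_lt_rank (hQ : IsSpectralDecomp B Q lam) (hB : B.PosSemidef)
    {i : Fin n} (hi : i.val < B.rank) : 0 < lam i := by
  refine lt_of_le_of_ne (hQ.nonneg hB i) fun h0 => ?_
  have hdet : IsUnit Q.det := (Matrix.isUnit_iff_isUnit_det Q).mp
    (IsUnit.of_mul_eq_one _ hQ.mul_transpose)
  have hdet' : IsUnit Q.transpose.det := by rwa [det_transpose]
  rw [hQ.eq, rank_mul_eq_left_of_isUnit_det _ _ hdet', rank_mul_eq_right_of_isUnit_det _ _ hdet,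
    rank_diagonal, Fintype.card_subtype] at hi
  -- If λᵢ = 0, monotonicity kills all later eigenvalues, leaving at most i nonzero ones, fewer than
  -- the rank.
  have hsub : (Finset.univ.filter fun j => lam j ≠ 0) ⊆ Finset.Iio i := by
    intro j hj
    rw [Finset.mem_Iio]
    by_contra hij
    exact (Finset.mem_filter.mp hj).2
      (le_antisymm (h0 ▸ hQ.antitone (not_lt.mp hij)) (hQ.nonneg hB j))
  have := Finset.card_le_card hsub
  rw [Fin.card_Iio] at this
  omega

/-- The eigenvalues of `coordApprox Q lam τ`. -/
def coordEigenvalue (lam : Fin n → ℝ) (τ : ℕ) (i : Fin n) : ℝ :=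
  lam ⟨min i.val (τ - 1), lt_of_le_of_lt (min_le_left _ _) i.isLt⟩ +
    ∑ j : Fin n with τ ≤ j.val, lam j

theorem IsSpectralDecomp.coordApprox_eq (hQ : IsSpectralDecomp B Q lam) (τ : ℕ) :
    coordApprox Q lam τ = Q * diagonal (coordEigenvalue lam τ) * Q.transpose := by
  have h : diagonal (coordEigenvalue lam τ) =
      diagonal (fun i : Fin n => lam ⟨min i.val (τ - 1),
        lt_of_le_of_lt (min_le_left _ _) i.isLt⟩) +
      (∑ i : Fin n with τ ≤ i.val, lam i) • (1 : Matrix (Fin n) (Fin n) ℝ) := by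
    rw [smul_one_eq_diagonal, diagonal_add]
    rfl
  rw [h, Matrix.mul_add, Matrix.add_mul, Matrix.mul_smul, Matrix.smul_mul, Matrix.mul_one,
    hQ.mul_transpose, coordApprox]

theorem IsSpectralDecomp.coordEigenvalue_pos (hQ : IsSpectralDecomp B Q lam) (hB : B.PosSemidef)
    {τ : ℕ} (hτ : 1 ≤ τ) (hτB : τ ≤ B.rank) (i : Fin n) : 0 < coordEigenvalue lam τ i := by
  refine add_pos_of_pos_of_nonneg (hQ.pos_of_lt_rank hB ?_)
    (Finset.sum_nonneg fun j _ => hQ.nonneg hB j)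
  have := min_le_right i.val (τ - 1)
  simp only
  omega

theorem IsSpectralDecomp.matSeminorm_inv_coordApprox_sq (hQ : IsSpectralDecomp B Q lam)
    (hB : B.PosSemidef) {τ : ℕ} (hτ : 1 ≤ τ) (hτB : τ ≤ B.rank)
    (v : EuclideanSpace ℝ (Fin n)) :
    matSeminorm (coordApprox Q lam τ)⁻¹ v ^ 2 =
      ∑ i, (Q.transpose *ᵥ v.ofLp) i ^ 2 / coordEigenvalue lam τ i := by
  have hpos := hQ.coordEigenvalue_pos hB hτ hτB
  have hinv : (coordApprox Q lam τ)⁻¹ =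
      Q * diagonal (fun i => (coordEigenvalue lam τ i)⁻¹) * Q.transpose := by
    refine inv_eq_right_inv ?_
    have hd : diagonal (coordEigenvalue lam τ) * diagonal (fun i => (coordEigenvalue lam τ i)⁻¹) =
        1 := by
      rw [diagonal_mul_diagonal, ← diagonal_one]
      congr 1
      ext i
      exact mul_inv_cancel₀ (hpos i).ne'
    calc coordApprox Q lam τ * (Q * diagonal (fun i => (coordEigenvalue lam τ i)⁻¹) * Q.transpose)
        = Q * diagonal (coordEigenvalue lam τ) * (Q.transpose * Q) *
            diagonal (fun i => (coordEigenvalue lam τ i)⁻¹) * Q.transpose := by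
          rw [hQ.coordApprox_eq]
          simp only [Matrix.mul_assoc]
      _ = Q * (diagonal (coordEigenvalue lam τ) *
            diagonal (fun i => (coordEigenvalue lam τ i)⁻¹)) * Q.transpose := by
          rw [hQ.transpose_mul, Matrix.mul_one]
          simp only [Matrix.mul_assoc]
      _ = 1 := by rw [hd, Matrix.mul_one, hQ.mul_transpose]
  have hq : v.ofLp ⬝ᵥ ((coordApprox Q lam τ)⁻¹ *ᵥ v.ofLp) =
      ∑ i, (Q.transpose *ᵥ v.ofLp) i ^ 2 / coordEigenvalue lam τ i := by
    rw [hinv, ← mulVec_mulVec, ← mulVec_mulVec, dotProduct_mulVec, ← mulVec_transpose, dotProduct]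
    refine Finset.sum_congr rfl fun i _ => ?_
    rw [mulVec_diagonal]
    ring
  rw [matSeminorm_sq, hq]
  rw [hq]
  exact Finset.sum_nonneg fun i _ => div_nonneg (sq_nonneg _) (hpos i).le

theorem IsSpectralDecomp.transpose_mulVec_eq_zero (hQ : IsSpectralDecomp B Q lam)
    {g : Fin n → ℝ} (hg : ∀ v, B *ᵥ v = 0 → g ⬝ᵥ v = 0) (w : Fin n → ℝ)
    (hw : diagonal lam *ᵥ w = 0) : (Q.transpose *ᵥ g) ⬝ᵥ w = 0 := by
  rw [mulVec_transpose, ← dotProduct_mulVec]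
  apply hg
  rw [hQ.eq, mulVec_mulVec, Matrix.mul_assoc, Matrix.mul_assoc, hQ.transpose_mul, Matrix.mul_one,
    ← mulVec_mulVec, hw, mulVec_zero]

theorem IsSpectralDecomp.sum_det_principalSub (hQ : IsSpectralDecomp B Q lam) (k : ℕ) :
    ∑ S ∈ Finset.univ.powersetCard k, (principalSub B S).det =
      ∑ S ∈ Finset.univ.powersetCard k, ∏ i ∈ S, lam i := by
  rw [hQ.eq]
  refine (sum_minors_orthogonal_conj _ Q hQ.transpose_mul k).trans
    (Finset.sum_congr rfl fun S _ => det_principalSub_diagonal lam S)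

/-- `sum_det_mul_quadratic` is applied to (B, g) and, in reverse, to (Diag(λ), Qᵀg); orthogonal
invariance of the minor sums links the two. -/
theorem IsSpectralDecomp.sum_det_mul_quadratic_eq (hQ : IsSpectralDecomp B Q lam)
    (hB : B.PosSemidef) (g : EuclideanSpace ℝ (Fin n))
    (hg : ∀ v, B *ᵥ v = 0 → g.ofLp ⬝ᵥ v = 0) (k : ℕ) :
    ∑ S ∈ Finset.univ.powersetCard k, (principalSub B S).det *
        (subvec g S ⬝ᵥ ((principalSub B S)⁻¹ *ᵥ subvec g S)) =
      ∑ i, (Q.transpose *ᵥ g.ofLp) i ^ 2 *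
        ∑ S ∈ Finset.univ.powersetCard k with i ∈ S, ∏ j ∈ S.erase i, lam j := by
  set h : EuclideanSpace ℝ (Fin n) := WithLp.toLp 2 (Q.transpose *ᵥ g.ofLp) with hdef
  have hh := hQ.transpose_mulVec_eq_zero hg
  have hzero : ∀ i, lam i = 0 → h i = 0 := by
    intro i hi
    have := hh (Pi.single i 1) (by ext j; by_cases hj : j = i <;> simp_all [mulVec_diagonal])
    simpa using this
  have hconj : B + vecMulVec g.ofLp g.ofLp =
      Q * (diagonal lam + vecMulVec h.ofLp h.ofLp) * Q.transpose := by
    rw [Matrix.mul_add, Matrix.add_mul, ← hQ.eq, mul_vecMulVec, vecMulVec_mul, vecMul_transpose,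
      hdef, mulVec_mulVec, hQ.mul_transpose, one_mulVec]
  have hinv : ∑ S ∈ Finset.univ.powersetCard k,
      (principalSub (B + vecMulVec g.ofLp g.ofLp) S).det = ∑ S ∈ Finset.univ.powersetCard k,
      (principalSub (diagonal lam + vecMulVec h.ofLp h.ofLp) S).det := by
    rw [hconj]
    exact sum_minors_orthogonal_conj _ Q hQ.transpose_mul k
  have hinv' : ∑ S ∈ Finset.univ.powersetCard k, (principalSub B S).det =
      ∑ S ∈ Finset.univ.powersetCard k, (principalSub (diagonal lam) S).det := by
    rw [hQ.sum_det_principalSub]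
    simp only [det_principalSub_diagonal]
  rw [sum_det_mul_quadratic hB g hg, hinv, hinv',
    ← sum_det_mul_quadratic (hQ.diagonal_posSemidef hB) h hh]
  simp_rw [det_mul_quadratic_diagonal lam h hzero, Finset.mul_sum]
  refine Finset.sum_comm' fun S i => ?_
  simp

theorem IsSpectralDecomp.sum_det_le (hQ : IsSpectralDecomp B Q lam) (hB : B.PosSemidef)
    {τ : ℕ} (hτ : 1 ≤ τ) (hτB : τ ≤ B.rank) (i : Fin n) :
    ∑ S ∈ Finset.univ.powersetCard τ, (principalSub B S).det ≤ coordEigenvalue lam τ i *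
      ∑ S ∈ Finset.univ.powersetCard τ with i ∈ S, ∏ j ∈ S.erase i, lam j := by
  have hn : τ ≤ n := hτB.trans (by simpa using B.rank_le_width)
  have hmeet : ∀ (K : Finset (Fin n)), (Finset.univ \ K).card < τ →
      ∀ T ∈ Finset.univ.powersetCard τ, ∃ j ∈ T, j ∈ K := by
    intro K hK T hT
    by_contra! hTK
    have hsub : T ⊆ Finset.univ \ K := fun j hj => by simpa using hTK j hj
    have := Finset.card_le_card hsub
    rw [(Finset.mem_powersetCard.mp hT).2] at this
    omega
  have key : ∃ K : Finset (Fin n), i ∈ K ∧ (Finset.univ \ K).card < τ ∧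
      coordEigenvalue lam τ i = ∑ j ∈ K, lam j := by
    let p : Fin n := ⟨min i.val (τ - 1), lt_of_le_of_lt (min_le_left _ _) i.isLt⟩
    let q : Fin n := ⟨τ - 1, by omega⟩
    have hp : p ∉ Finset.univ.filter fun j : Fin n => τ ≤ j.val := by
      simp only [Finset.mem_filter, Finset.mem_univ, true_and, p]
      omega
    -- K consists of the tail indices ≥ τ (counting from 0) and p = min(i, τ − 1). If i < τ then p =
    -- i, otherwise i lies in the tail. Exactly τ − 1 indices are left out, too few to contain a
    -- τ-set.
    refine ⟨insert p (Finset.univ.filter fun j : Fin n => τ ≤ j.val), ?_, ?_, ?_⟩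
    · simp only [Finset.mem_insert, Finset.mem_filter, Finset.mem_univ, true_and, p, Fin.ext_iff]
      omega
    · have hpI : p ∈ Finset.Iic q := by simp [p, q]
      have hsub : Finset.univ \ insert p (Finset.univ.filter fun j : Fin n => τ ≤ j.val) ⊆
          (Finset.Iic q).erase p := by
        intro j hj
        simp only [Finset.mem_sdiff, Finset.mem_univ, Finset.mem_insert, Finset.mem_filter,
          true_and, not_or] at hj
        rw [Finset.mem_erase, Finset.mem_Iic, Fin.le_def]
        refine ⟨hj.1, ?_⟩
        simp only [q]
        omega
      have := Finset.card_le_card hsub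
      rw [Finset.card_erase_of_mem hpI, Fin.card_Iic] at this
      simp only [q] at this
      omega
    · rw [Finset.sum_insert hp]
      rfl
  obtain ⟨K, hiK, hK, hsum⟩ := key
  rw [hQ.sum_det_principalSub, hsum]
  exact sum_powersetCard_prod_le Finset.univ lam (hQ.nonneg hB) τ (Finset.mem_univ i) K hiK
    (hmeet K hK)

theorem IsSpectralDecomp.sum_det_pos (hQ : IsSpectralDecomp B Q lam) (hB : B.PosSemidef)
    {τ : ℕ} (hτB : τ ≤ B.rank) :
    0 < ∑ S ∈ Finset.univ.powersetCard τ, (principalSub B S).det := by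
  have hn : τ ≤ n := hτB.trans (by simpa using B.rank_le_width)
  rw [hQ.sum_det_principalSub]
  refine Finset.sum_pos' (fun S _ => Finset.prod_nonneg fun i _ => hQ.nonneg hB i)
    -- The set of the first τ indices has a positive product because τ ≤ rank B.
    ⟨Finset.univ.map (Fin.castLEEmb hn), ?_, Finset.prod_pos fun i hi => ?_⟩
  · simp [Finset.mem_powersetCard]
  · obtain ⟨j, -, rfl⟩ := Finset.mem_map.mp hi
    exact hQ.pos_of_lt_rank hB (lt_of_lt_of_le j.isLt hτB)

end VolumeSum

/-! ### Expectation over the finite sample space and conclusion. -/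

theorem sum_coordSubset {n : ℕ} (τ : ℕ) (F : Finset (Fin n) → ℝ) :
    ∑ S : CoordSubset n τ, F S.val = ∑ S ∈ Finset.univ.powersetCard τ, F S :=
  (Finset.sum_subtype _ (fun S => by simp) F).symm

theorem integrable_and_integral_of_finite_range {α Ω : Type*} [Fintype α] [MeasurableSpace Ω]
    (μ : Measure Ω) [IsFiniteMeasure μ] {S : Ω → α} (hS : Measurable[_, ⊤] S) (F : α → ℝ) :
    Integrable (fun ω => F (S ω)) μ ∧
      ∫ ω, F (S ω) ∂μ = ∑ a, μ.real {ω | S ω = a} * F a := by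
  let _ : MeasurableSpace α := ⊤
  have hF : Integrable F (μ.map S) := .of_finite
  refine ⟨hF.comp_measurable hS, ?_⟩
  rw [← integral_map hS.aemeasurable hF.aestronglyMeasurable, integral_fintype hF]
  refine Finset.sum_congr rfl fun a _ => ?_
  rw [map_measureReal_apply hS (measurableSet_singleton a), smul_eq_mul]
  rfl

end RCDVS

theorem lemma3p5 {n τ : ℕ} (B : Matrix (Fin n) (Fin n) ℝ) (hB : B.PosSemidef)
    (hτ : 1 ≤ τ) (hτB : τ ≤ B.rank)
    (f : EuclideanSpace ℝ (Fin n) → ℝ) (hf : RCDVS.IsOneSmooth f B)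
    (hbdd : BddBelow (Set.range f))
    (x₀ : EuclideanSpace ℝ (Fin n))
    {Ω : Type*} [MeasurableSpace Ω] (μ : Measure Ω) [IsProbabilityMeasure μ]
    (S₀ : Ω → RCDVS.CoordSubset n τ) (hS₀ : RCDVS.IsVolumeSampling μ B S₀)
    (Q : Matrix (Fin n) (Fin n) ℝ) (lam : Fin n → ℝ) (hQ : RCDVS.IsSpectralDecomp B Q lam) :
    (∀ᵐ ω ∂μ, f (RCDVS.step f B x₀ (S₀ ω).val) ≤ f x₀) ∧
    Integrable (fun ω => f (RCDVS.step f B x₀ (S₀ ω).val)) μ ∧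
    f x₀ - ∫ ω, f (RCDVS.step f B x₀ (S₀ ω).val) ∂μ ≥
      1 / 2 * RCDVS.matSeminorm (RCDVS.coordApprox Q lam τ)⁻¹ (gradient f x₀) ^ 2 := by
  open RCDVS Matrix in
  have hg := hf.gradient_dotProduct_eq_zero hB hbdd x₀
  obtain ⟨hint, hval⟩ := integrable_and_integral_of_finite_range μ hS₀.measurable
    (fun S => f (step f B x₀ S.val))
  -- Descent holds for every block, singular ones included, so no null set has to be discarded.
  refine ⟨.of_forall fun ω => ?_, hint, ?_⟩
  · have h := hf.step_le hB x₀ (S₀ ω).val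
    have := quadratic_nonneg (principalSub_posSemidef hB (S₀ ω).val).inv
      (subvec (gradient f x₀) (S₀ ω).val)
    linarith
  set e := ∑ S ∈ Finset.univ.powersetCard τ, (principalSub B S).det with he
  have hepos : 0 < e := hQ.sum_det_pos hB hτB
  have hp : ∀ S : CoordSubset n τ,
      μ.real {ω | S₀ ω = S} = (principalSub B S.val).det / e := fun S => by
    rw [hS₀.prob_eq, sum_coordSubset τ fun S => (principalSub B S).det]
  have hgain : ∑ i, (Q.transpose *ᵥ (gradient f x₀).ofLp) i ^ 2 / coordEigenvalue lam τ i ≤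
      (∑ S ∈ Finset.univ.powersetCard τ, (principalSub B S).det *
        (subvec (gradient f x₀) S ⬝ᵥ
          ((principalSub B S)⁻¹ *ᵥ subvec (gradient f x₀) S))) / e := by
    rw [hQ.sum_det_mul_quadratic_eq hB _ hg, Finset.sum_div]
    refine Finset.sum_le_sum fun i _ => ?_
    -- The comparison is made separately for each eigendirection; clearing denominators leaves
    -- e_τ(λ) ≤ μᵢ ∂ᵢe_τ(λ), multiplied by hᵢ².
    rw [div_le_div_iff₀ (hQ.coordEigenvalue_pos hB hτ hτB i) hepos, mul_assoc]
    refine mul_le_mul_of_nonneg_left ?_ (sq_nonneg _)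
    rw [mul_comm]
    exact hQ.sum_det_le hB hτ hτB i
  have hsum : ∫ ω, f (step f B x₀ (S₀ ω).val) ∂μ ≤
      ∑ S ∈ Finset.univ.powersetCard τ, (principalSub B S).det / e * (f x₀ -
        1 / 2 * (subvec (gradient f x₀) S ⬝ᵥ
          ((principalSub B S)⁻¹ *ᵥ subvec (gradient f x₀) S))) := by
    rw [hval, ← sum_coordSubset]
    refine Finset.sum_le_sum fun S _ => ?_
    rw [hp]
    exact mul_le_mul_of_nonneg_left (hf.step_le hB x₀ S.val)
      (div_nonneg (principalSub_posSemidef hB S.val).det_nonneg hepos.le)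
  have hsplit : ∑ S ∈ Finset.univ.powersetCard τ, (principalSub B S).det / e * (f x₀ -
        1 / 2 * (subvec (gradient f x₀) S ⬝ᵥ
          ((principalSub B S)⁻¹ *ᵥ subvec (gradient f x₀) S))) =
      f x₀ - 1 / 2 * ((∑ S ∈ Finset.univ.powersetCard τ, (principalSub B S).det *
        (subvec (gradient f x₀) S ⬝ᵥ
          ((principalSub B S)⁻¹ *ᵥ subvec (gradient f x₀) S))) / e) := by
    have h1 : f x₀ = ∑ S ∈ Finset.univ.powersetCard τ, (principalSub B S).det / e * f x₀ := by
      rw [← Finset.sum_mul, ← Finset.sum_div, div_self hepos.ne', one_mul]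
    conv_rhs => rw [h1]
    rw [Finset.sum_div, Finset.mul_sum, ← Finset.sum_sub_distrib]
    refine Finset.sum_congr rfl fun S _ => ?_
    ring
  rw [hQ.matSeminorm_inv_coordApprox_sq hB hτ hτB]
  linarith
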